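/- Fix $q\in\mathbb C$ with $0<|q|<1$ together with a logarithm $\kappa$ of $q$ ($e^{\kappa}=q$), and write $q^{c}=e^{c\kappa}$ for $c\in\mathbb C$. Put $(z)_\infty=\prod_{n\ge 0}(1-zq^n)$ and $(z_1,\dots,z_r)_\infty=(z_1)_\infty\cdots(z_r)_\infty$. The Jackson integrals are $$\int_0^{\tau}f(t)\frac{d_qt}{t}=(1-q)\sum_{n=0}^{\infty}f(\tau q^n),\qquad \int_0^{\tau\infty}f(t)\frac{d_qt}{t}=(1-q)\sum_{n=-\infty}^{\infty}f(\tau q^n),\qquad \int_{\tau_1}^{\tau_2}=\int_0^{\tau_2}-\int_0^{\tau_1},$$ with $\int_0^0=0$ and $\int f(s)\,d_qs=\int s f(s)\frac{d_qs}{s}$. Let $T_x$ be the $q$-shift $T_xf(x)=f(qx)$. Powers such as $t^\alpha$, $x^\lambda$ are regarded as functions on the universal cover of $\mathbb C^{\times}$, where the $q$-shift adds $\kappa$ to the logarithm; thus $(qt)^\alpha=q^\alpha t^\alpha$, and the branches of $\tau^{\alpha}$ at the limits of integration below are arbitrary (for $\tau=q/(Ax)$, continuous in $\log x$). Let $A,B,a_1,a_2,b_1,b_2\in\mathbb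 C^{\times}$ and $\alpha,\lambda\in\mathbb C$ satisfy $$Aa_1a_2=q^{\alpha+1}Bb_1b_2,\qquad q^{\lambda}=B/A\notin q^{\mathbb Z_{\ge -1}},\qquad q^{\alpha+1}B/A\notin q^{\mathbb Z_{\le 0}},$$ and let $$\mathcal E_2=\Big[x^{2}(1-q^{\alpha}T_x)(B-AT_x)-x\big((a_1+a_2)-q^{\alpha}(b_1+b_2)T_x\big)(1-T_x)+\frac{a_1a_2}{B}(1-q^{-1}T_x)(1-T_x)\Big]T_x^{-1}.$$ Then the functions $$\varphi_2(x)=\int_{\tau_1}^{\tau_2}t^{\alpha}\frac{(Axt,a_1t,a_2t)_\infty}{(Bxt,b_1t,b_2t)_\infty}\frac{d_qt}{t},\qquad \tau_1,\tau_2\in\{0,\ q/a_1,\ q/a_2,\ q/(Ax)\},$$ $$\tilde\varphi_2(x)=x^{\lambda}\int_{\sigma_1}^{\sigma_2}\frac{(qs/(Bx),qs/b_1,qs/b_2)_\infty}{(qs/(Ax),qs/a_1,qs/a_2)_\infty}\,d_qs,\qquad \sigma_1,\sigma_2\in\{b_1,\ b_2,\ Bx\}\cup\{\sigma\infty:\sigma\in\mathbb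 C^{\times}\},$$ satisfy $\mathcal E_2\varphi_2=0$ and $\mathcal E_2\tilde\varphi_2=0$ at every point $x\ne0$ such that at $x/q$, $x$ and $qx$ the integrals over $[0,\tau_i]$ (respectively over $[0,\sigma_i]$) are defined, that is, the denominator of the integrand does not vanish at any point at which the Jackson integral evaluates it, and the series converges. Moreover, when these denominators do not vanish, the series converges automatically in the first integral if $|q^{\alpha}|<1$, and in the second integral if the limit is $b_1$, $b_2$ or $Bx$, or if it is $\sigma\infty$ and $|q^\alpha|<1$. -/

import Mathlib

noncomputable section

namespace QHyp

/-- Parameters (pure data, no hypotheses). `κ` is the chosen logarithm of the base `q = exp κ`,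
so that `q ^ c` means `exp (c * κ)` for every complex `c`.

Multivalued functions of a nonzero variable such as `t ^ α` or `x ^ lam` are treated as functions on
the universal cover of the punctured plane: the coordinate on the cover is `ξ` with `x = exp ξ`
(resp. `u` with `t = exp u`), and the `q`-shift `x ↦ q x` is `ξ ↦ ξ + κ`. -/
structure Params where
  κ : ℂ
  α : ℂ
  lam : ℂ
  A : ℂ
  B : ℂ
  a : Fin 2 → ℂ
  b : Fin 2 → ℂ

/-- The infinite `q`-Pochhammer symbol `(z)_∞ = ∏_{n ≥ 0} (1 - z q ^ n)`. -/
def qPoch (q z : ℂ) : ℂ := ∏' n : ℕ, (1 - z * q ^ n)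

/-- A limit of integration on the cover: the point `0`, the point `τ = exp u`, or `τ∞` with
`τ = exp u`. -/
inductive Limit where
  | zero : Limit
  | pt (u : ℂ) : Limit
  | inf (u : ℂ) : Limit

namespace Limit

/-- The Jackson integral from `0` of `F(t) d_q t / t`:
`∫_0^τ = (1 - q) ∑_{n ≥ 0} F(τ q ^ n)`, `∫_0^{τ∞} = (1 - q) ∑_{n ∈ ℤ} F(τ q ^ n)`. -/
def integral (κ : ℂ) (F : ℂ → ℂ) : Limit → ℂ
  | zero => 0
  | pt u => (1 - Complex.exp κ) * ∑' n : ℕ, F (u + n * κ)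
  | inf u => (1 - Complex.exp κ) * ∑' n : ℤ, F (u + n * κ)

/-- Convergence of the series in the Jackson integral. -/
def Converges (κ : ℂ) (F : ℂ → ℂ) : Limit → Prop
  | zero => True
  | pt u => Summable fun n : ℕ => F (u + n * κ)
  | inf u => Summable fun n : ℤ => F (u + n * κ)

/-- The points at which the Jackson integral evaluates its integrand. -/
def nodes (κ : ℂ) : Limit → Set ℂ
  | zero => ∅
  | pt u => Set.range fun n : ℕ => u + n * κ
  | inf u => Set.range fun n : ℤ => u + n * κ

end Limit

/-- `∫_{τ₁}^{τ₂} F(t) d_q t / t`. -/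
def jackson (κ : ℂ) (F : ℂ → ℂ) (τ₁ τ₂ : Limit) : ℂ :=
  τ₂.integral κ F - τ₁.integral κ F

namespace Params

variable (P : Params)

/-- The base `q`. -/
def q : ℂ := Complex.exp P.κ

/-- The complex power `q ^ c`, with the chosen logarithm of `q`. -/
def qPow (c : ℂ) : ℂ := Complex.exp (c * P.κ)

/-- Numerator of the first integrand: `t ^ α (Axt, a₁t, a₂t)_∞`, with `x = exp ξ`, `t = exp u`. -/
def psiNum (ξ u : ℂ) : ℂ :=
  Complex.exp (P.α * u) * (qPoch P.q (P.A * Complex.exp ξ * Complex.exp u) *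
    ∏ i, qPoch P.q (P.a i * Complex.exp u))

/-- Denominator of the first integrand: `(Bxt, b₁t, b₂t)_∞`. -/
def psiDen (ξ u : ℂ) : ℂ :=
  qPoch P.q (P.B * Complex.exp ξ * Complex.exp u) * ∏ i, qPoch P.q (P.b i * Complex.exp u)

/-- The first integrand (with respect to `d_q t / t`). -/
def psi (ξ u : ℂ) : ℂ := P.psiNum ξ u / P.psiDen ξ u

/-- Numerator of the dual integrand: `s (qs/(Bx), qs/b₁, qs/b₂)_∞`, with `x = exp ξ`, `s = exp u`;
the factor `s` turns `d_q s` into `d_q s / s`. -/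
def dualNum (ξ u : ℂ) : ℂ :=
  Complex.exp u * (qPoch P.q (P.q * Complex.exp u / (P.B * Complex.exp ξ)) *
    ∏ i, qPoch P.q (P.q * Complex.exp u / P.b i))

/-- Denominator of the dual integrand: `(qs/(Ax), qs/a₁, qs/a₂)_∞`. -/
def dualDen (ξ u : ℂ) : ℂ :=
  qPoch P.q (P.q * Complex.exp u / (P.A * Complex.exp ξ)) *
    ∏ i, qPoch P.q (P.q * Complex.exp u / P.a i)

/-- The dual integrand (with respect to `d_q s / s`). -/
def dual (ξ u : ℂ) : ℂ := P.dualNum ξ u / P.dualDen ξ u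

/-- The limits `τ ∈ {0, q/a₁, q/a₂, q/(Ax)}`, as functions of `ξ` (`x = exp ξ`); each nonzero limit
is lifted to the cover by an arbitrary choice `c` of a logarithm, i.e. of a branch of `τ ^ α`. -/
inductive IsTau : (ℂ → Limit) → Prop
  | zero : IsTau fun _ => Limit.zero
  | overA (i : Fin 2) (c : ℂ) (hc : Complex.exp c = P.q / P.a i) : IsTau fun _ => Limit.pt c
  | overAx (c : ℂ) (hc : Complex.exp c = P.q / P.A) : IsTau fun ξ => Limit.pt (c - ξ)

/-- The limits `σ ∈ {b₁, b₂, Bx, σ∞}`, where in the last case `σ = exp c` is an arbitrary nonzero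
constant. (The dual integrand is single-valued in `s`, so the choice of logarithm is immaterial.) -/
inductive IsSigma : (ℂ → Limit) → Prop
  | b (i : Fin 2) (c : ℂ) (hc : Complex.exp c = P.b i) : IsSigma fun _ => Limit.pt c
  | Bx (c : ℂ) (hc : Complex.exp c = P.B) : IsSigma fun ξ => Limit.pt (c + ξ)
  | inf (c : ℂ) : IsSigma fun _ => Limit.inf c

/-- `φ₂(x, τ₁, τ₂) = ∫_{τ₁}^{τ₂} t ^ α (Axt, a₁t, a₂t)_∞ / (Bxt, b₁t, b₂t)_∞ d_q t / t`. -/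
def phi (τ₁ τ₂ : ℂ → Limit) (ξ : ℂ) : ℂ :=
  jackson P.κ (P.psi ξ) (τ₁ ξ) (τ₂ ξ)

/-- `x ^ lam ∫_{σ₁}^{σ₂} (qs/(Bx), qs/b₁, qs/b₂)_∞ / (qs/(Ax), qs/a₁, qs/a₂)_∞ d_q s`. -/
def phiDual (σ₁ σ₂ : ℂ → Limit) (ξ : ℂ) : ℂ :=
  Complex.exp (P.lam * ξ) * jackson P.κ (P.dual ξ) (σ₁ ξ) (σ₂ ξ)

/-- The first integrand has no vanishing denominator at any node of the limit `τ`. -/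
def TauRegular (τ : ℂ → Limit) (ξ : ℂ) : Prop :=
  ∀ u ∈ (τ ξ).nodes P.κ, P.psiDen ξ u ≠ 0

/-- The dual integrand has no vanishing denominator at any node of the limit `σ`. -/
def SigmaRegular (σ : ℂ → Limit) (ξ : ℂ) : Prop :=
  ∀ u ∈ (σ ξ).nodes P.κ, P.dualDen ξ u ≠ 0

/-- The Jackson integral of the first integrand from `0` to `τ` makes sense at `x = exp ξ`. -/
def TauDefined (τ : ℂ → Limit) (ξ : ℂ) : Prop :=
  P.TauRegular τ ξ ∧ (τ ξ).Converges P.κ (P.psi ξ)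

/-- The Jackson integral of the dual integrand from `0` to `σ` makes sense at `x = exp ξ`. -/
def SigmaDefined (σ : ℂ → Limit) (ξ : ℂ) : Prop :=
  P.SigmaRegular σ ξ ∧ (σ ξ).Converges P.κ (P.dual ξ)

/-- The `q`-shift operator `T_x`: `(T_x f)(x) = f(q x)`. -/
def T : Module.End ℂ (ℂ → ℂ) := LinearMap.funLeft ℂ ℂ fun ξ => ξ + P.κ

/-- The inverse `q`-shift `T_x⁻¹`: `(T_x⁻¹ f)(x) = f(x / q)`. -/
def Tinv : Module.End ℂ (ℂ → ℂ) := LinearMap.funLeft ℂ ℂ fun ξ => ξ - P.κ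

/-- Multiplication by `x = exp ξ`. -/
def X : Module.End ℂ (ℂ → ℂ) := LinearMap.mulLeft ℂ Complex.exp

/-- The operator
`E₂ = [x² (1 - q^α T)(B - A T) - x (e₁(a) - q^α e₁(b) T)(1 - T)
  + e₂(a) B⁻¹ (1 - q⁻¹ T)(1 - T)] T⁻¹`. -/
def E₂ : Module.End ℂ (ℂ → ℂ) :=
  (X ^ 2 * (1 - P.qPow P.α • P.T) * (P.B • 1 - P.A • P.T)
    - X * ((P.a 0 + P.a 1) • 1 - (P.qPow P.α * (P.b 0 + P.b 1)) • P.T) * (1 - P.T)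
    + (P.a 0 * P.a 1 * P.B⁻¹) • ((1 - P.q⁻¹ • P.T) * (1 - P.T))) * P.Tinv

end Params

end QHyp

end

noncomputable section

open Filter Topology

namespace QHyp

/-! ### The infinite `q`-Pochhammer symbol -/

theorem multipliable_qPoch {q : ℂ} (hq : ‖q‖ < 1) (z : ℂ) :
    Multipliable fun n : ℕ => 1 - z * q ^ n := by
  simp only [sub_eq_add_neg]
  refine multipliable_one_add_of_summable ?_
  simpa using (summable_geometric_of_lt_one (norm_nonneg q) hq).mul_left ‖z‖

theorem qPoch_eq_mul {q : ℂ} (hq : ‖q‖ < 1) (z : ℂ) :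
    qPoch q z = (1 - z) * qPoch q (q * z) := by
  have h : (fun n : ℕ => 1 - z * q ^ (n + 1)) = fun n => 1 - q * z * q ^ n :=
    funext fun n => by ring
  have hm : Multipliable fun n : ℕ => 1 - z * q ^ (n + 1) := h ▸ multipliable_qPoch hq (q * z)
  have e := tprod_eq_zero_mul' (f := fun n : ℕ => 1 - z * q ^ n) hm
  rw [h, pow_zero, mul_one] at e
  exact e

theorem qPoch_one {q : ℂ} (hq : ‖q‖ < 1) : qPoch q 1 = 0 := by
  rw [qPoch_eq_mul hq, sub_self, zero_mul]

theorem norm_qPoch_sub_one_le {q : ℂ} (hq : ‖q‖ < 1) (z : ℂ) :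
    ‖qPoch q z - 1‖ ≤ Real.exp (‖z‖ * (1 - ‖q‖)⁻¹) - 1 := by
  have ht := ((multipliable_qPoch hq z).hasProd.tendsto_prod_nat.sub_const 1).norm
  refine le_of_tendsto' ht fun N => ?_
  have h := Finset.norm_prod_one_add_sub_one_le (Finset.range N) fun n : ℕ => -(z * q ^ n)
  simp only [← sub_eq_add_neg] at h
  refine h.trans (sub_le_sub_right (Real.exp_le_exp.2 ?_) 1)
  have hg := (hasSum_geometric_of_lt_one (norm_nonneg q) hq).mul_left ‖z‖
  simpa using sum_le_hasSum (Finset.range N) (fun i _ => by positivity) hg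

theorem tendsto_qPoch {q : ℂ} (hq : ‖q‖ < 1) : Tendsto (qPoch q) (𝓝 0) (𝓝 1) := by
  rw [tendsto_iff_norm_sub_tendsto_zero]
  have h : Tendsto (fun z : ℂ => Real.exp (‖z‖ * (1 - ‖q‖)⁻¹) - 1) (𝓝 0) (𝓝 0) := by
    have : Continuous fun z : ℂ => Real.exp (‖z‖ * (1 - ‖q‖)⁻¹) - 1 := by fun_prop
    simpa using this.tendsto 0
  exact squeeze_zero (fun _ => norm_nonneg _) (norm_qPoch_sub_one_le hq) h

/-! ### Telescoping series -/

theorem tsum_telescope {f G : ℕ → ℂ} {k L : ℂ} (hf : Summable f)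
    (h : ∀ n, f n = k * (G (n + 1) - G n)) (hG : Tendsto G atTop (𝓝 L)) :
    ∑' n, f n = k * (L - G 0) := by
  refine tendsto_nhds_unique hf.hasSum.tendsto_sum_nat ?_
  simp only [h, ← Finset.mul_sum, Finset.sum_range_sub]
  exact (hG.sub_const _).const_mul k

theorem tsum_int_telescope {f G : ℤ → ℂ} {k L M : ℂ} (hf : Summable f)
    (h : ∀ n, f n = k * (G (n + 1) - G n))
    (hL : Tendsto (fun n : ℕ => G n) atTop (𝓝 L))
    (hM : Tendsto (fun n : ℕ => G (-n)) atTop (𝓝 M)) :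
    ∑' n, f n = k * (L - M) := by
  have h1 : Summable fun n : ℕ => f n := hf.comp_injective Nat.cast_injective
  have h2 : Summable fun n : ℕ => f (-(n + 1)) :=
    hf.comp_injective fun a b hab => by simpa using hab
  rw [tsum_of_nat_of_neg_add_one h1 h2,
    tsum_telescope (G := fun n : ℕ => G n) h1 (fun n => by simpa using h n) hL,
    tsum_telescope (G := fun n : ℕ => G (-n)) (k := -k) h2 (fun n => ?_) hM]
  · simp only [Nat.cast_zero, neg_zero]
    ring
  · rw [h]
    simp only [neg_add_rev, Nat.cast_add, Nat.cast_one]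
    ring_nf

theorem hasSum_linear_combination {ι : Type*} {f₀ f₁ f₂ : ι → ℂ} (c₀ c₁ c₂ : ℂ)
    (h₀ : Summable f₀) (h₁ : Summable f₁) (h₂ : Summable f₂) :
    HasSum (fun n => c₀ * f₀ n + c₁ * f₁ n + c₂ * f₂ n)
      (c₀ * ∑' n, f₀ n + c₁ * ∑' n, f₁ n + c₂ * ∑' n, f₂ n) :=
  ((h₀.hasSum.mul_left c₀).add (h₁.hasSum.mul_left c₁)).add (h₂.hasSum.mul_left c₂)

theorem summable_mul_of_tendsto {f r : ℕ → ℂ} {L : ℂ} (hf : Summable f)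
    (hr : Tendsto r atTop (𝓝 L)) : Summable fun n => f n * r n := by
  refine summable_of_isBigO_nat hf.norm ?_
  simpa using (Asymptotics.isBigO_refl f atTop).norm_right.mul (hr.isBigO_one ℝ)

namespace Limit

theorem integral_pt_add {κ : ℂ} {F : ℂ → ℂ} {u : ℂ} (h : F u = 0)
    (hs : (pt (u + κ)).Converges κ F) :
    (pt u).Converges κ F ∧ (pt (u + κ)).integral κ F = (pt u).integral κ F := by
  have e : ∀ n : ℕ, F (u + κ + n * κ) = F (u + (n + 1 : ℕ) * κ) := fun n => by
    push_cast
    ring_nf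
  simp only [Converges, e] at hs
  have hs' : Summable fun n : ℕ => F (u + n * κ) :=
    (summable_nat_add_iff (f := fun n : ℕ => F (u + n * κ)) 1).1 hs
  refine ⟨hs', ?_⟩
  simp only [integral, e]
  rw [hs'.tsum_eq_zero_add]
  simp [h]

end Limit

namespace Params

variable (P : Params)

/-- Coefficients of `E₂` with respect to `T⁻¹`, `1`, `T`. -/
def coeffInv (x : ℂ) : ℂ := P.B * x ^ 2 - (P.a 0 + P.a 1) * x + P.a 0 * P.a 1 / P.B

def coeffOne (x : ℂ) : ℂ :=
  -((P.A + P.qPow P.α * P.B) * x ^ 2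
    - (P.a 0 + P.a 1 + P.qPow P.α * (P.b 0 + P.b 1)) * x + P.a 0 * P.a 1 / P.B * (1 + P.q⁻¹))

def coeffT (x : ℂ) : ℂ :=
  P.qPow P.α * P.A * x ^ 2 - P.qPow P.α * (P.b 0 + P.b 1) * x + P.a 0 * P.a 1 / P.B * P.q⁻¹

theorem E₂_apply (f : ℂ → ℂ) (ξ : ℂ) :
    P.E₂ f ξ = P.coeffInv (Complex.exp ξ) * f (ξ - P.κ) + P.coeffOne (Complex.exp ξ) * f ξ
      + P.coeffT (Complex.exp ξ) * f (ξ + P.κ) := by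
  simp only [E₂, T, Tinv, X, coeffInv, coeffOne, coeffT, pow_two, Module.End.mul_apply,
    LinearMap.add_apply, LinearMap.sub_apply, LinearMap.smul_apply, Module.End.one_apply,
    Pi.add_apply, Pi.sub_apply, Pi.smul_apply, Pi.mul_apply, LinearMap.mulLeft_apply,
    LinearMap.funLeft_apply, map_sub, map_smul, smul_eq_mul, add_sub_cancel_right]
  ring

theorem q_ne_zero : P.q ≠ 0 := Complex.exp_ne_zero _

theorem qPow_add_one : P.qPow (P.α + 1) = P.qPow P.α * P.q := by
  rw [qPow, qPow, q, ← Complex.exp_add]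
  ring_nf

theorem exp_add_nat_mul (u : ℂ) (n : ℕ) :
    Complex.exp (u + n * P.κ) = Complex.exp u * P.q ^ n := by
  rw [Complex.exp_add, q, ← Complex.exp_nat_mul]

theorem tendsto_exp_node (hq : ‖P.q‖ < 1) (u : ℂ) :
    Tendsto (fun n : ℕ => Complex.exp (u + n * P.κ)) atTop (𝓝 0) := by
  simp only [exp_add_nat_mul]
  simpa using (tendsto_pow_atTop_nhds_zero_of_norm_lt_one hq).const_mul (Complex.exp u)

theorem tendsto_qPoch_node (hq : ‖P.q‖ < 1) (c u : ℂ) :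
    Tendsto (fun n : ℕ => qPoch P.q (c * Complex.exp (u + n * P.κ))) atTop (𝓝 1) := by
  refine (tendsto_qPoch hq).comp ?_
  simpa using (P.tendsto_exp_node hq u).const_mul c

/-! ### The first integral -/

/-- The certificate `t ^ α (Axt, a₁t/q, a₂t/q)_∞ / (Bxt/q, b₁t, b₂t)_∞`. -/
def psiCert (ξ u : ℂ) : ℂ :=
  Complex.exp (P.α * u) * (qPoch P.q (P.A * Complex.exp ξ * Complex.exp u) *
    (qPoch P.q (P.a 0 / P.q * Complex.exp u) * qPoch P.q (P.a 1 / P.q * Complex.exp u))) /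
  (qPoch P.q (P.B * Complex.exp ξ / P.q * Complex.exp u) *
    (qPoch P.q (P.b 0 * Complex.exp u) * qPoch P.q (P.b 1 * Complex.exp u)))

theorem psi_telescope (hq : ‖P.q‖ < 1) (hB : P.B ≠ 0)
    (hrel : P.A * P.a 0 * P.a 1 = P.qPow (P.α + 1) * P.B * P.b 0 * P.b 1) {ξ u : ℂ}
    (hu : P.psiDen (ξ - P.κ) u ≠ 0) :
    P.coeffInv (Complex.exp ξ) * P.psi (ξ - P.κ) u + P.coeffOne (Complex.exp ξ) * P.psi ξ u
      + P.coeffT (Complex.exp ξ) * P.psi (ξ + P.κ) u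
      = (P.A - P.B) * Complex.exp ξ ^ 2 * (P.psiCert ξ (u + P.κ) - P.psiCert ξ u) := by
  have hq0 := P.q_ne_zero
  obtain ⟨w, hw⟩ : ∃ w, Complex.exp u = P.q * w := ⟨Complex.exp u / P.q, by field_simp⟩
  have e1 : Complex.exp (u + P.κ) = P.q * Complex.exp u := by rw [Complex.exp_add, q, mul_comm]
  have e2 : Complex.exp (ξ - P.κ) = Complex.exp ξ / P.q := by rw [Complex.exp_sub, q]
  have e3 : Complex.exp (ξ + P.κ) = P.q * Complex.exp ξ := by rw [Complex.exp_add, q, mul_comm]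
  have e4 : Complex.exp (P.α * (u + P.κ)) = P.qPow P.α * Complex.exp (P.α * u) := by
    rw [qPow, ← Complex.exp_add]
    ring_nf
  rw [qPow_add_one] at hrel
  simp only [psi, psiNum, psiDen, psiCert, Fin.prod_univ_two, coeffInv, coeffOne, coeffT,
    e1, e2, e3, e4, hw] at hu ⊢
  generalize Complex.exp (P.α * u) = E at *
  generalize Complex.exp ξ = x at *
  generalize P.qPow P.α = Q at *
  generalize P.a 0 = a₀ at *
  generalize P.a 1 = a₁ at *
  generalize P.b 0 = b₀ at *
  generalize P.b 1 = b₁ at *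
  generalize P.A = A at *
  generalize P.B = B at *
  generalize P.q = q at *
  have hA2 : qPoch q (A * x * (q * w)) =
      (1 - A * x * q * w) * qPoch q (A * (q * x) * (q * w)) := by
    rw [qPoch_eq_mul hq]
    congr 2 <;> ring
  have hA1 : qPoch q (A * (x / q) * (q * w)) =
      (1 - A * x * w) * ((1 - A * x * q * w) * qPoch q (A * (q * x) * (q * w))) := by
    rw [← hA2, qPoch_eq_mul hq]
    congr 2 <;> field_simp
  have hA3 : A * x * (q * (q * w)) = A * (q * x) * (q * w) := by ring
  have hB2 : qPoch q (B * x * (q * w)) =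
      (1 - B * x * q * w) * qPoch q (B * (q * x) * (q * w)) := by
    rw [qPoch_eq_mul hq]
    congr 2 <;> ring
  have hB1 : qPoch q (B * (x / q) * (q * w)) =
      (1 - B * x * w) * ((1 - B * x * q * w) * qPoch q (B * (q * x) * (q * w))) := by
    rw [← hB2, qPoch_eq_mul hq]
    congr 2 <;> field_simp
  have hB3 : qPoch q (B * x / q * (q * (q * w))) =
      (1 - B * x * q * w) * qPoch q (B * (q * x) * (q * w)) := by
    rw [← hB2]
    congr 1
    field_simp
  have hB4 : qPoch q (B * x / q * (q * w)) =
      (1 - B * x * w) * ((1 - B * x * q * w) * qPoch q (B * (q * x) * (q * w))) := by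
    rw [← hB1]
    congr 1
    field_simp
  have ha : ∀ a, qPoch q (a / q * (q * w)) = (1 - a * w) * qPoch q (a * (q * w)) := fun a => by
    rw [qPoch_eq_mul hq]
    congr 2 <;> field_simp
  have ha' : ∀ a, a / q * (q * (q * w)) = a * (q * w) := fun a => by field_simp
  have hb : ∀ b, qPoch q (b * (q * w)) = (1 - b * q * w) * qPoch q (b * (q * (q * w))) :=
    fun b => by
      rw [qPoch_eq_mul hq]
      congr 2 <;> ring
  rw [hA3, ha', ha', ha, ha, hA1, hA2, hB3, hB4, hB1, hB2, hb b₀, hb b₁]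
  rw [hB1, hb b₀, hb b₁] at hu
  generalize qPoch q (A * (q * x) * (q * w)) = pA at *
  generalize qPoch q (B * (q * x) * (q * w)) = pB at *
  generalize qPoch q (a₀ * (q * w)) = p0 at *
  generalize qPoch q (a₁ * (q * w)) = p1 at *
  generalize qPoch q (b₀ * (q * (q * w))) = r0 at *
  generalize qPoch q (b₁ * (q * (q * w))) = r1 at *
  simp only [ne_eq, mul_eq_zero, not_or] at hu
  obtain ⟨⟨h1, h2, h3⟩, ⟨h4, h5⟩, h6, h7⟩ := hu
  generalize hd1 : 1 - B * x * w = d1 at *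
  generalize hd2 : 1 - B * x * q * w = d2 at *
  generalize hd3 : 1 - b₀ * q * w = d3 at *
  generalize hd4 : 1 - b₁ * q * w = d4 at *
  field_simp
  subst hd1 hd2 hd3 hd4
  linear_combination E * pA * p0 * p1 * x ^ 2 * w ^ 2 * q ^ 2 * (A - B) * (1 - B * x * w) * hrel

/-! ### The second integral -/

/-- The certificate `(qs/(Bx), s/b₁, s/b₂)_∞ / (s/(Ax), qs/a₁, qs/a₂)_∞`. -/
def dualCert (ξ u : ℂ) : ℂ :=
  (qPoch P.q (P.q / (P.B * Complex.exp ξ) * Complex.exp u) *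
    (qPoch P.q (1 / P.b 0 * Complex.exp u) * qPoch P.q (1 / P.b 1 * Complex.exp u))) /
  (qPoch P.q (1 / (P.A * Complex.exp ξ) * Complex.exp u) *
    (qPoch P.q (P.q / P.a 0 * Complex.exp u) * qPoch P.q (P.q / P.a 1 * Complex.exp u)))

theorem dual_telescope (hq : ‖P.q‖ < 1) (hA : P.A ≠ 0) (hB : P.B ≠ 0)
    (ha : ∀ i, P.a i ≠ 0) (hb : ∀ i, P.b i ≠ 0)
    (hrel : P.A * P.a 0 * P.a 1 = P.qPow (P.α + 1) * P.B * P.b 0 * P.b 1) {ξ u : ℂ}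
    (hu : P.dualDen (ξ + P.κ) u ≠ 0) :
    P.coeffInv (Complex.exp ξ) * (P.A / P.B * P.dual (ξ - P.κ) u)
      + P.coeffOne (Complex.exp ξ) * P.dual ξ u
      + P.coeffT (Complex.exp ξ) * (P.B / P.A * P.dual (ξ + P.κ) u)
      = (P.A - P.B) * P.a 0 * P.a 1 * Complex.exp ξ / (P.q * P.B) *
        (P.dualCert ξ (u + P.κ) - P.dualCert ξ u) := by
  have hq0 := P.q_ne_zero
  have hx := Complex.exp_ne_zero ξ
  have e1 : Complex.exp (u + P.κ) = P.q * Complex.exp u := by rw [Complex.exp_add, q, mul_comm]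
  have e2 : Complex.exp (ξ - P.κ) = Complex.exp ξ / P.q := by rw [Complex.exp_sub, q]
  have e3 : Complex.exp (ξ + P.κ) = P.q * Complex.exp ξ := by rw [Complex.exp_add, q, mul_comm]
  have ha0 := ha 0
  have ha1 := ha 1
  have hb0 := hb 0
  have hb1 := hb 1
  rw [qPow_add_one] at hrel
  simp only [dual, dualNum, dualDen, dualCert, Fin.prod_univ_two, coeffInv, coeffOne, coeffT,
    e1, e2, e3] at hu ⊢
  generalize Complex.exp u = s at *
  generalize Complex.exp ξ = x at *
  generalize P.qPow P.α = Q at *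
  generalize P.a 0 = a₀ at *
  generalize P.a 1 = a₁ at *
  generalize P.b 0 = b₀ at *
  generalize P.b 1 = b₁ at *
  generalize P.A = A at *
  generalize P.B = B at *
  generalize P.q = q at *
  have hs : ∀ c, c ≠ 0 → qPoch q (1 / c * s) = (1 - s / c) * qPoch q (q * s / c) := fun c hc => by
    rw [qPoch_eq_mul hq]
    congr 2 <;> field_simp
  have hqs : ∀ c, c ≠ 0 → qPoch q (q * s / c) = (1 - q * s / c) * qPoch q (q / c * (q * s)) :=
    fun c hc => by
      rw [qPoch_eq_mul hq]
      congr 2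
      field_simp
  have t1 : ∀ c, c ≠ 0 → q * s / (c * (x / q)) = q / (c * x) * (q * s) := fun c hc => by
    field_simp
  have t2 : ∀ c, c ≠ 0 → q * s / (c * (q * x)) = 1 / (c * x) * s := fun c hc => by
    field_simp
  have t3 : ∀ c, q / c * s = q * s / c := fun c => by ring
  have t4 : ∀ c, 1 / c * (q * s) = q * s / c := fun c => by ring
  rw [t2 A hA] at hu
  rw [t1 A hA, t1 B hB, t2 A hA, t2 B hB, t3, t3, t3, t4, t4, t4]
  rw [hs (A * x) (by positivity), hqs (A * x) (by positivity), hqs a₀ ha0, hqs a₁ ha1] at hu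
  rw [hs (A * x) (by positivity), hs (B * x) (by positivity), hs b₀ hb0, hs b₁ hb1,
    hqs (A * x) (by positivity), hqs (B * x) (by positivity), hqs a₀ ha0, hqs a₁ ha1]
  generalize qPoch q (q / (A * x) * (q * s)) = pA at *
  generalize qPoch q (q / (B * x) * (q * s)) = pB at *
  generalize qPoch q (q * s / b₀) = p0 at *
  generalize qPoch q (q * s / b₁) = p1 at *
  generalize qPoch q (q / a₀ * (q * s)) = r0 at *
  generalize qPoch q (q / a₁ * (q * s)) = r1 at *
  simp only [ne_eq, mul_eq_zero, not_or] at hu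
  obtain ⟨⟨h1, h2, h3⟩, ⟨h4, h5⟩, h6, h7⟩ := hu
  have g1 : 1 - s / (A * x) = (A * x - s) / (A * x) := by field_simp
  have g2 : 1 - q * s / (A * x) = (A * x - q * s) / (A * x) := by field_simp
  have g3 : 1 - q * s / a₀ = (a₀ - q * s) / a₀ := by field_simp
  have g4 : 1 - q * s / a₁ = (a₁ - q * s) / a₁ := by field_simp
  rw [g1, div_eq_zero_iff, not_or] at h1
  rw [g2, div_eq_zero_iff, not_or] at h2
  rw [g3, div_eq_zero_iff, not_or] at h4
  rw [g4, div_eq_zero_iff, not_or] at h6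
  obtain ⟨h1, -⟩ := h1
  obtain ⟨h2, -⟩ := h2
  obtain ⟨h4, -⟩ := h4
  obtain ⟨h6, -⟩ := h6
  rw [g1, g2, g3, g4]
  generalize hd1 : A * x - s = d1 at *
  generalize hd2 : A * x - q * s = d2 at *
  generalize hd3 : a₀ - q * s = d3 at *
  generalize hd4 : a₁ - q * s = d4 at *
  field_simp
  subst hd1 hd2 hd3 hd4
  linear_combination pB * p0 * p1 * (B - A) * x ^ 2 * s * (b₀ + b₁ - s) * (B * x - q * s) * hrel

theorem exp_add_kappa (u : ℂ) : Complex.exp (u + P.κ) = P.q * Complex.exp u := by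
  rw [Complex.exp_add, q, mul_comm]

theorem exp_sub_kappa (u : ℂ) : Complex.exp (u - P.κ) = Complex.exp u / P.q := by
  rw [Complex.exp_sub, q]

theorem tendsto_psiCert (hq : ‖P.q‖ < 1) {ξ u : ℂ}
    (h : Tendsto (fun n : ℕ => P.psi (ξ - P.κ) (u + n * P.κ)) atTop (𝓝 0)) :
    Tendsto (fun n : ℕ => P.psiCert ξ (u + n * P.κ)) atTop (𝓝 0) := by
  have t := P.tendsto_qPoch_node hq
  have hn := (t (P.A * Complex.exp ξ) u).mul ((t (P.a 0 / P.q) u).mul (t (P.a 1 / P.q) u))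
  have hd := (t (P.A * Complex.exp (ξ - P.κ)) u).mul ((t (P.a 0) u).mul (t (P.a 1) u))
  rw [mul_one, mul_one] at hn hd
  have key := h.mul (hn.div hd one_ne_zero)
  rw [zero_mul] at key
  refine key.congr' ?_
  filter_upwards [hd.eventually_ne one_ne_zero] with n hne
  simp only [psi, psiNum, psiDen, psiCert, Fin.prod_univ_two, Pi.div_apply]
  rw [P.exp_sub_kappa ξ] at hne ⊢
  rw [mul_div_assoc P.B]
  generalize qPoch P.q (P.A * (Complex.exp ξ / P.q) * Complex.exp (u + n * P.κ)) *
    (qPoch P.q (P.a 0 * Complex.exp (u + n * P.κ)) *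
      qPoch P.q (P.a 1 * Complex.exp (u + n * P.κ))) = N at hne ⊢
  rw [div_mul_div_comm, mul_right_comm _ N, mul_div_mul_right _ _ hne]

theorem tendsto_dualCert (hq : ‖P.q‖ < 1) (ξ u : ℂ) :
    Tendsto (fun n : ℕ => P.dualCert ξ (u + n * P.κ)) atTop (𝓝 1) := by
  have t := fun c => P.tendsto_qPoch_node hq c u
  have h := ((t (P.q / (P.B * Complex.exp ξ))).mul
    ((t (1 / P.b 0)).mul (t (1 / P.b 1)))).div ((t (1 / (P.A * Complex.exp ξ))).mul
    ((t (P.q / P.a 0)).mul (t (P.q / P.a 1)))) (by simp)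
  simp only [mul_one, div_one] at h
  exact h

theorem summable_psi (hq : ‖P.q‖ < 1) (hα : ‖P.qPow P.α‖ < 1) (ξ u : ℂ) :
    Summable fun n : ℕ => P.psi ξ (u + n * P.κ) := by
  have t := fun c => P.tendsto_qPoch_node hq c u
  have hr := ((t (P.A * Complex.exp ξ)).mul ((t (P.a 0)).mul (t (P.a 1)))).div
    ((t (P.B * Complex.exp ξ)).mul ((t (P.b 0)).mul (t (P.b 1)))) (by simp)
  have hg : Summable fun n : ℕ => Complex.exp (P.α * (u + n * P.κ)) := by
    refine ((summable_geometric_of_norm_lt_one hα).mul_left (Complex.exp (P.α * u))).congr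
      fun n => ?_
    rw [qPow, ← Complex.exp_nat_mul, ← Complex.exp_add]
    ring_nf
  refine (summable_mul_of_tendsto hg hr).congr fun n => ?_
  simp only [psi, psiNum, psiDen, Fin.prod_univ_two, Pi.div_apply, mul_div_assoc]

theorem summable_dual (hq : ‖P.q‖ < 1) (ξ u : ℂ) :
    Summable fun n : ℕ => P.dual ξ (u + n * P.κ) := by
  have t := fun c => P.tendsto_qPoch_node hq c u
  have hr := ((t (P.q / (P.B * Complex.exp ξ))).mul ((t (P.q / P.b 0)).mul (t (P.q / P.b 1)))).div
    ((t (P.q / (P.A * Complex.exp ξ))).mul ((t (P.q / P.a 0)).mul (t (P.q / P.a 1)))) (by simp)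
  have hg : Summable fun n : ℕ => Complex.exp (u + n * P.κ) := by
    simpa only [exp_add_nat_mul] using (summable_geometric_of_norm_lt_one hq).mul_left _
  refine (summable_mul_of_tendsto hg hr).congr fun n => ?_
  simp only [dual, dualNum, dualDen, Fin.prod_univ_two, Pi.div_apply, ← mul_div_assoc,
    div_mul_eq_mul_div]

/-- `dual(s) / dual(qs)` in terms of `v = 1/s`. -/
theorem dual_eq_mul_dual_add (hq : ‖P.q‖ < 1) (ξ u : ℂ) :
    P.dual ξ u = P.q⁻¹ *
      (((Complex.exp (-u) - P.q / (P.B * Complex.exp ξ)) *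
        ((Complex.exp (-u) - P.q / P.b 0) * (Complex.exp (-u) - P.q / P.b 1))) /
       ((Complex.exp (-u) - P.q / (P.A * Complex.exp ξ)) *
        ((Complex.exp (-u) - P.q / P.a 0) * (Complex.exp (-u) - P.q / P.a 1)))) *
      P.dual ξ (u + P.κ) := by
  have hs := Complex.exp_ne_zero u
  have hq0 := P.q_ne_zero
  have hv : Complex.exp u * Complex.exp (-u) = 1 := by
    rw [← Complex.exp_add, add_neg_cancel, Complex.exp_zero]
  simp only [dual, dualNum, dualDen, Fin.prod_univ_two, exp_add_kappa]
  generalize Complex.exp (-u) = v at *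
  generalize Complex.exp u = s at *
  generalize P.B * Complex.exp ξ = B at *
  generalize P.A * Complex.exp ξ = A at *
  generalize P.q = q at *
  have h : ∀ c, qPoch q (q * s / c) =
      s * (v - q / c) * qPoch q (q * (q * s) / c) := fun c => by
    rw [qPoch_eq_mul hq, mul_sub, hv, mul_div_assoc' s, mul_comm s q, mul_div_assoc' q]
  rw [h A, h B, h (P.a 0), h (P.a 1), h (P.b 0), h (P.b 1)]
  rw [mul_assoc q⁻¹, div_mul_div_comm, ← mul_div_assoc]
  refine Eq.trans ?_ (mul_div_mul_left _ _ (pow_ne_zero 3 hs))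
  congr 1
  · linear_combination (-s ^ 4 * (v - q / B) * (v - q / P.b 0) * (v - q / P.b 1)
      * qPoch q (q * (q * s) / B) * qPoch q (q * (q * s) / P.b 0) * qPoch q (q * (q * s) / P.b 1))
      * inv_mul_cancel₀ hq0
  · ring

theorem summable_dual_neg (hq : ‖P.q‖ < 1) (hA : P.A ≠ 0) (hB : P.B ≠ 0)
    (ha : ∀ i, P.a i ≠ 0) (hb : ∀ i, P.b i ≠ 0)
    (hrel : P.A * P.a 0 * P.a 1 = P.qPow (P.α + 1) * P.B * P.b 0 * P.b 1)
    (hα : ‖P.qPow P.α‖ < 1) (ξ u : ℂ) :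
    Summable fun n : ℕ => P.dual ξ (u + (-n : ℤ) * P.κ) := by
  have hq0 := P.q_ne_zero
  have hx := Complex.exp_ne_zero ξ
  have ha0 := ha 0
  have ha1 := ha 1
  have hb0 := hb 0
  have hb1 := hb 1
  have hv : Tendsto (fun n : ℕ => Complex.exp (-(u + (-(n + 1 : ℕ) : ℤ) * P.κ))) atTop (𝓝 0) := by
    have := (tendsto_add_atTop_iff_nat 1).2 (P.tendsto_exp_node hq (-u))
    refine this.congr fun n => ?_
    push_cast
    ring_nf
  have t : ∀ c, Tendsto (fun n : ℕ =>
      Complex.exp (-(u + (-(n + 1 : ℕ) : ℤ) * P.κ)) - P.q / c) atTop (𝓝 (0 - P.q / c)) :=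
    fun c => hv.sub_const _
  have hr := ((((t (P.B * Complex.exp ξ)).mul ((t (P.b 0)).mul (t (P.b 1)))).div
    ((t (P.A * Complex.exp ξ)).mul ((t (P.a 0)).mul (t (P.a 1))))
    (by simp [*])).const_mul P.q⁻¹).norm
  have hlim : P.q⁻¹ * ((0 - P.q / (P.B * Complex.exp ξ)) * ((0 - P.q / P.b 0) * (0 - P.q / P.b 1)) /
      ((0 - P.q / (P.A * Complex.exp ξ)) * ((0 - P.q / P.a 0) * (0 - P.q / P.a 1))))
      = P.qPow P.α := by
    rw [qPow_add_one] at hrel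
    simp only [zero_sub]
    field_simp
    linear_combination hrel
  rw [hlim] at hr
  obtain ⟨r, hr1, hr2⟩ := exists_between hα
  refine summable_of_ratio_norm_eventually_le hr2 ?_
  filter_upwards [hr.eventually_le_const hr1] with n hn
  have e : u + (-(n : ℕ) : ℤ) * P.κ = u + (-(n + 1 : ℕ) : ℤ) * P.κ + P.κ := by
    push_cast
    ring
  rw [e, P.dual_eq_mul_dual_add hq, norm_mul]
  exact mul_le_mul_of_nonneg_right hn (norm_nonneg _)

theorem dualCert_eq_mul_dual (hq : ‖P.q‖ < 1) (hA : P.A ≠ 0) {ξ u : ℂ}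
    (hu : P.dualDen (ξ + P.κ) u ≠ 0) :
    P.dualCert ξ u =
      ((Complex.exp (-u) - 1 / P.b 0) * (Complex.exp (-u) - 1 / P.b 1) *
        (Complex.exp (-u) - P.q / (P.B * Complex.exp ξ))) /
      ((Complex.exp (-u) - 1 / (P.A * Complex.exp ξ)) *
        (Complex.exp (-u) - P.q / (P.A * Complex.exp ξ))) * P.dual (ξ - P.κ) u := by
  have hs := Complex.exp_ne_zero u
  have hq0 := P.q_ne_zero
  have hx := Complex.exp_ne_zero ξ
  have hv : Complex.exp (-u) = (Complex.exp u)⁻¹ := Complex.exp_neg u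
  simp only [dual, dualNum, dualDen, dualCert, Fin.prod_univ_two, exp_add_kappa,
    exp_sub_kappa, hv] at hu ⊢
  generalize Complex.exp u = s at *
  generalize Complex.exp ξ = x at *
  generalize P.q = q at *
  generalize P.A = A at *
  have h1 : ∀ c, qPoch q (1 / c * s) = s * (s⁻¹ - 1 / c) * qPoch q (q / c * s) := fun c => by
    rw [qPoch_eq_mul hq, mul_sub, mul_inv_cancel₀ hs, mul_comm s (1 / c), ← mul_assoc,
      mul_one_div]
  have h2 : ∀ c, qPoch q (q / c * s) =
      s * (s⁻¹ - q / c) * qPoch q (q * s / (c / q)) := fun c => by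
    rw [qPoch_eq_mul hq, mul_sub, mul_inv_cancel₀ hs, mul_comm s (q / c)]
    congr 2
    field_simp
  have h3 : q * s / (A * (q * x)) = 1 / (A * x) * s := by field_simp
  have h5 : ∀ c, q * s / c = q / c * s := fun c => by rw [div_mul_eq_mul_div]
  rw [h3, h1, h2 (A * x)] at hu
  rw [h1 (P.b 0), h1 (P.b 1), h1 (A * x), h2 (A * x), h2 (P.B * x), ← mul_div_assoc A,
    ← mul_div_assoc P.B, h5 (P.b 0), h5 (P.b 1), h5 (P.a 0), h5 (P.a 1)]
  rw [h5 (P.a 0), h5 (P.a 1)] at hu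
  simp only [ne_eq, mul_eq_zero, not_or] at hu
  obtain ⟨⟨⟨-, h1⟩, ⟨-, h2⟩, h3⟩, h4, h5⟩ := hu
  generalize s⁻¹ - 1 / P.b 0 = n0 at *
  generalize s⁻¹ - 1 / P.b 1 = n1 at *
  generalize s⁻¹ - q / (P.B * x) = n2 at *
  generalize s⁻¹ - 1 / (A * x) = d0 at *
  generalize s⁻¹ - q / (A * x) = d1 at *
  generalize qPoch q (q * s / (A * x / q)) = r0 at *
  generalize qPoch q (q * s / (P.B * x / q)) = r1 at *
  generalize qPoch q (q / P.a 0 * s) = r2 at *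
  generalize qPoch q (q / P.a 1 * s) = r3 at *
  generalize qPoch q (q / P.b 0 * s) = r4 at *
  generalize qPoch q (q / P.b 1 * s) = r5 at *
  field_simp

theorem one_sub_div_mul_zpow_neg_ne_zero {n : ℤ} (h : P.B / P.A ≠ P.q ^ n) :
    1 - P.B / P.A * P.q ^ (-n) ≠ 0 := fun h' => h <| by
  rwa [zpow_neg, sub_eq_zero, eq_mul_inv_iff_mul_eq₀ (zpow_ne_zero n P.q_ne_zero), one_mul,
    eq_comm] at h'

theorem psi_integral_pt (hq : ‖P.q‖ < 1) (hB : P.B ≠ 0)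
    (hrel : P.A * P.a 0 * P.a 1 = P.qPow (P.α + 1) * P.B * P.b 0 * P.b 1) {ξ u : ℂ}
    (hu : ∀ n : ℕ, P.psiDen (ξ - P.κ) (u + n * P.κ) ≠ 0)
    (h₀ : (Limit.pt u).Converges P.κ (P.psi (ξ - P.κ)))
    (h₁ : (Limit.pt u).Converges P.κ (P.psi ξ))
    (h₂ : (Limit.pt u).Converges P.κ (P.psi (ξ + P.κ))) (hG : P.psiCert ξ u = 0) :
    P.coeffInv (Complex.exp ξ) * (Limit.pt u).integral P.κ (P.psi (ξ - P.κ))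
      + P.coeffOne (Complex.exp ξ) * (Limit.pt u).integral P.κ (P.psi ξ)
      + P.coeffT (Complex.exp ξ) * (Limit.pt u).integral P.κ (P.psi (ξ + P.κ)) = 0 := by
  simp only [Limit.Converges] at h₀ h₁ h₂
  have hs := hasSum_linear_combination (P.coeffInv (Complex.exp ξ)) (P.coeffOne (Complex.exp ξ))
    (P.coeffT (Complex.exp ξ)) h₀ h₁ h₂
  have ht := tsum_telescope (G := fun n : ℕ => P.psiCert ξ (u + n * P.κ)) hs.summable
    (fun n => by
      rw [P.psi_telescope hq hB hrel (hu n)]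
      push_cast
      rw [add_one_mul (n : ℂ), ← add_assoc])
    (P.tendsto_psiCert hq h₀.tendsto_atTop_zero)
  rw [hs.tsum_eq, Nat.cast_zero, zero_mul, add_zero, hG, sub_zero, mul_zero] at ht
  simp only [Limit.integral]
  linear_combination (1 - Complex.exp P.κ) * ht

theorem psi_integral (hq : ‖P.q‖ < 1) (hA : P.A ≠ 0) (hB : P.B ≠ 0) (ha : ∀ i, P.a i ≠ 0)
    (hrel : P.A * P.a 0 * P.a 1 = P.qPow (P.α + 1) * P.B * P.b 0 * P.b 1)
    (hBA : ∀ n : ℤ, -1 ≤ n → P.B / P.A ≠ P.q ^ n) {τ : ℂ → Limit} (hτ : P.IsTau τ) {ξ : ℂ}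
    (h₀ : P.TauDefined τ (ξ - P.κ)) (h₁ : P.TauDefined τ ξ) (h₂ : P.TauDefined τ (ξ + P.κ)) :
    P.coeffInv (Complex.exp ξ) * (τ (ξ - P.κ)).integral P.κ (P.psi (ξ - P.κ))
      + P.coeffOne (Complex.exp ξ) * (τ ξ).integral P.κ (P.psi ξ)
      + P.coeffT (Complex.exp ξ) * (τ (ξ + P.κ)).integral P.κ (P.psi (ξ + P.κ)) = 0 := by
  have hq0 := P.q_ne_zero
  have hx := Complex.exp_ne_zero ξ
  cases hτ with
  | zero => simp [Limit.integral]
  | overA i c hc =>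
    refine P.psi_integral_pt hq hB hrel (fun n => h₀.1 _ ⟨n, rfl⟩) h₀.2 h₁.2 h₂.2 ?_
    have h : qPoch P.q (P.a i / P.q * Complex.exp c) = 0 := by
      rw [hc, div_mul_div_cancel₀ hq0, div_self (ha i), qPoch_one hq]
    fin_cases i <;> simp_all [psiCert]
  | overAx c hc =>
    obtain ⟨u, hu⟩ : ∃ u, u = c - (ξ + P.κ) := ⟨_, rfl⟩
    have e1 : c - ξ = u + P.κ := by rw [hu]; ring
    have e0 : c - (ξ - P.κ) = u + P.κ + P.κ := by rw [hu]; ring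
    have hexp : Complex.exp u = 1 / (P.A * Complex.exp ξ) := by
      rw [hu, Complex.exp_sub, hc, exp_add_kappa]
      field_simp
    simp only [TauDefined, TauRegular, e0, e1, ← hu] at h₀ h₁ h₂ ⊢
    have z1 : P.psi ξ u = 0 := by
      have : P.A * Complex.exp ξ * Complex.exp u = 1 := by rw [hexp]; field_simp
      simp [psi, psiNum, this, qPoch_one hq]
    have z0 : ∀ v, v = u ∨ v = u + P.κ → P.psi (ξ - P.κ) v = 0 := by
      intro v hv
      have : qPoch P.q (P.A * Complex.exp (ξ - P.κ) * Complex.exp v) = 0 := by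
        rcases hv with rfl | rfl
        · have : P.q * (P.A * Complex.exp (ξ - P.κ) * Complex.exp v) = 1 := by
            rw [hexp, exp_sub_kappa]; field_simp
          rw [qPoch_eq_mul hq, this, qPoch_one hq, mul_zero]
        · have : P.A * Complex.exp (ξ - P.κ) * Complex.exp (u + P.κ) = 1 := by
            rw [exp_add_kappa, hexp, exp_sub_kappa]; field_simp
          rw [this, qPoch_one hq]
      simp [psi, psiNum, this]
    obtain ⟨c1, i1⟩ := Limit.integral_pt_add z1 h₁.2
    obtain ⟨c0, i0⟩ := Limit.integral_pt_add (z0 _ (Or.inr rfl)) h₀.2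
    obtain ⟨c0', i0'⟩ := Limit.integral_pt_add (z0 _ (Or.inl rfl)) c0
    rw [i1, i0, i0']
    refine P.psi_integral_pt hq hB hrel ?_ c0' c1 h₂.2 ?_
    · have hb := fun n : ℕ => h₂.1 (u + n * P.κ) ⟨n, rfl⟩
      have key := fun n hn => P.one_sub_div_mul_zpow_neg_ne_zero (hBA n hn)
      have hstep : ∀ v, P.psiDen (ξ + P.κ) v ≠ 0 →
          1 - P.B * Complex.exp ξ * Complex.exp v / P.q ≠ 0 →
          1 - P.B * Complex.exp ξ * Complex.exp v ≠ 0 → P.psiDen (ξ - P.κ) v ≠ 0 := by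
        intro v h h' h''
        rw [psiDen, mul_ne_zero_iff] at h ⊢
        refine ⟨?_, h.2⟩
        have q1 : P.B * Complex.exp (ξ - P.κ) * Complex.exp v =
            P.B * Complex.exp ξ * Complex.exp v / P.q := by rw [exp_sub_kappa]; ring
        have q2 : P.q * (P.B * Complex.exp ξ * Complex.exp v) =
            P.B * Complex.exp (ξ + P.κ) * Complex.exp v := by rw [exp_add_kappa]; ring
        rw [q1, qPoch_eq_mul hq, mul_div_cancel₀ _ hq0, qPoch_eq_mul hq, q2]
        exact mul_ne_zero h' (mul_ne_zero h'' h.1)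
      rintro (_ | _ | n)
      · refine hstep _ (hb 0) ?_ ?_
        · convert key 1 (by norm_num) using 2
          simp only [Nat.cast_zero, zero_mul, add_zero, hexp, zpow_neg, zpow_one]
          field_simp
        · convert key 0 (by norm_num) using 2
          simp only [Nat.cast_zero, zero_mul, add_zero, hexp, neg_zero, zpow_zero]
          field_simp
      · refine hstep _ (hb 1) ?_ ?_
        · convert key 0 (by norm_num) using 2
          simp only [zero_add, Nat.cast_one, one_mul, exp_add_kappa, hexp, neg_zero, zpow_zero]
          field_simp
        · convert key (-1) (by norm_num) using 2
          simp only [zero_add, Nat.cast_one, one_mul, exp_add_kappa, hexp, neg_neg, zpow_one]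
          field_simp
      · convert h₀.1 _ ⟨n, rfl⟩ using 2
        push_cast
        ring
    · have : P.A * Complex.exp ξ * Complex.exp u = 1 := by rw [hexp]; field_simp
      simp [psiCert, this, qPoch_one hq]

theorem dual_integral_pt (hq : ‖P.q‖ < 1) (hA : P.A ≠ 0) (hB : P.B ≠ 0)
    (ha : ∀ i, P.a i ≠ 0) (hb : ∀ i, P.b i ≠ 0)
    (hrel : P.A * P.a 0 * P.a 1 = P.qPow (P.α + 1) * P.B * P.b 0 * P.b 1) {ξ u : ℂ}
    (hu : ∀ n : ℕ, P.dualDen (ξ + P.κ) (u + n * P.κ) ≠ 0) (hG : P.dualCert ξ u = 0) :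
    P.coeffInv (Complex.exp ξ) * (P.A / P.B * (Limit.pt u).integral P.κ (P.dual (ξ - P.κ)))
      + P.coeffOne (Complex.exp ξ) * (Limit.pt u).integral P.κ (P.dual ξ)
      + P.coeffT (Complex.exp ξ) * (P.B / P.A * (Limit.pt u).integral P.κ (P.dual (ξ + P.κ)))
      = (1 - Complex.exp P.κ) *
        ((P.A - P.B) * P.a 0 * P.a 1 * Complex.exp ξ / (P.q * P.B)) := by
  have hs := hasSum_linear_combination (P.coeffInv (Complex.exp ξ)) (P.coeffOne (Complex.exp ξ))
    (P.coeffT (Complex.exp ξ)) ((P.summable_dual hq (ξ - P.κ) u).mul_left (P.A / P.B))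
    (P.summable_dual hq ξ u) ((P.summable_dual hq (ξ + P.κ) u).mul_left (P.B / P.A))
  have ht := tsum_telescope (G := fun n : ℕ => P.dualCert ξ (u + n * P.κ)) hs.summable
    (fun n => by
      rw [P.dual_telescope hq hA hB ha hb hrel (hu n)]
      push_cast
      rw [add_one_mul (n : ℂ), ← add_assoc])
    (P.tendsto_dualCert hq ξ u)
  rw [hs.tsum_eq, Nat.cast_zero, zero_mul, add_zero, hG, sub_zero, mul_one, tsum_mul_left,
    tsum_mul_left] at ht
  simp only [Limit.integral]
  linear_combination (1 - Complex.exp P.κ) * ht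

theorem tendsto_dualCert_neg (hq : ‖P.q‖ < 1) (hA : P.A ≠ 0) {ξ u : ℂ}
    (hu : ∀ n : ℤ, P.dualDen (ξ + P.κ) (u + n * P.κ) ≠ 0)
    (h : Tendsto (fun n : ℕ => P.dual (ξ - P.κ) (u + (-n : ℤ) * P.κ)) atTop (𝓝 0)) :
    Tendsto (fun n : ℕ => P.dualCert ξ (u + (-n : ℤ) * P.κ)) atTop (𝓝 0) := by
  have hv : Tendsto (fun n : ℕ => Complex.exp (-(u + (-n : ℤ) * P.κ))) atTop (𝓝 0) := by
    refine (P.tendsto_exp_node hq (-u)).congr fun n => ?_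
    push_cast
    ring_nf
  have t : ∀ c, Tendsto (fun n : ℕ => Complex.exp (-(u + (-n : ℤ) * P.κ)) - c) atTop
      (𝓝 (0 - c)) := fun c => hv.sub_const _
  have hr := ((((t (1 / P.b 0)).mul (t (1 / P.b 1))).mul (t (P.q / (P.B * Complex.exp ξ)))).div
    ((t (1 / (P.A * Complex.exp ξ))).mul (t (P.q / (P.A * Complex.exp ξ))))
    (by simp [hA, P.q_ne_zero])).mul h
  rw [mul_zero] at hr
  exact hr.congr fun n => (P.dualCert_eq_mul_dual hq hA (hu (-n))).symm

theorem dual_integral_inf (hq : ‖P.q‖ < 1) (hA : P.A ≠ 0) (hB : P.B ≠ 0)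
    (ha : ∀ i, P.a i ≠ 0) (hb : ∀ i, P.b i ≠ 0)
    (hrel : P.A * P.a 0 * P.a 1 = P.qPow (P.α + 1) * P.B * P.b 0 * P.b 1) {ξ u : ℂ}
    (hu : ∀ n : ℤ, P.dualDen (ξ + P.κ) (u + n * P.κ) ≠ 0)
    (h₀ : (Limit.inf u).Converges P.κ (P.dual (ξ - P.κ)))
    (h₁ : (Limit.inf u).Converges P.κ (P.dual ξ))
    (h₂ : (Limit.inf u).Converges P.κ (P.dual (ξ + P.κ))) :
    P.coeffInv (Complex.exp ξ) * (P.A / P.B * (Limit.inf u).integral P.κ (P.dual (ξ - P.κ)))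
      + P.coeffOne (Complex.exp ξ) * (Limit.inf u).integral P.κ (P.dual ξ)
      + P.coeffT (Complex.exp ξ) * (P.B / P.A * (Limit.inf u).integral P.κ (P.dual (ξ + P.κ)))
      = (1 - Complex.exp P.κ) *
        ((P.A - P.B) * P.a 0 * P.a 1 * Complex.exp ξ / (P.q * P.B)) := by
  simp only [Limit.Converges] at h₀ h₁ h₂
  have hs := hasSum_linear_combination (P.coeffInv (Complex.exp ξ)) (P.coeffOne (Complex.exp ξ))
    (P.coeffT (Complex.exp ξ)) (h₀.mul_left (P.A / P.B)) h₁ (h₂.mul_left (P.B / P.A))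
  have h0 : Summable fun n : ℕ => P.dual (ξ - P.κ) (u + (-n : ℤ) * P.κ) :=
    h₀.comp_injective (i := fun n : ℕ => (-n : ℤ)) fun a b hab => by simpa using hab
  have ht := tsum_int_telescope (G := fun n : ℤ => P.dualCert ξ (u + n * P.κ)) hs.summable
    (fun n => by
      rw [P.dual_telescope hq hA hB ha hb hrel (hu n)]
      push_cast
      rw [add_one_mul (n : ℂ), ← add_assoc])
    (by simpa using P.tendsto_dualCert hq ξ u)
    (P.tendsto_dualCert_neg hq hA hu h0.tendsto_atTop_zero)
  rw [hs.tsum_eq, sub_zero, mul_one, tsum_mul_left, tsum_mul_left] at ht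
  simp only [Limit.integral]
  linear_combination (1 - Complex.exp P.κ) * ht

theorem dual_integral (hq : ‖P.q‖ < 1) (hA : P.A ≠ 0) (hB : P.B ≠ 0)
    (ha : ∀ i, P.a i ≠ 0) (hb : ∀ i, P.b i ≠ 0)
    (hrel : P.A * P.a 0 * P.a 1 = P.qPow (P.α + 1) * P.B * P.b 0 * P.b 1)
    (hBA : ∀ n : ℤ, -1 ≤ n → P.B / P.A ≠ P.q ^ n) {σ : ℂ → Limit} (hσ : P.IsSigma σ) {ξ : ℂ}
    (h₀ : P.SigmaDefined σ (ξ - P.κ)) (h₁ : P.SigmaDefined σ ξ)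
    (h₂ : P.SigmaDefined σ (ξ + P.κ)) :
    P.coeffInv (Complex.exp ξ) * (P.A / P.B * (σ (ξ - P.κ)).integral P.κ (P.dual (ξ - P.κ)))
      + P.coeffOne (Complex.exp ξ) * (σ ξ).integral P.κ (P.dual ξ)
      + P.coeffT (Complex.exp ξ) * (P.B / P.A * (σ (ξ + P.κ)).integral P.κ (P.dual (ξ + P.κ)))
      = (1 - Complex.exp P.κ) *
        ((P.A - P.B) * P.a 0 * P.a 1 * Complex.exp ξ / (P.q * P.B)) := by
  have hq0 := P.q_ne_zero
  have hx := Complex.exp_ne_zero ξ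
  cases hσ with
  | inf c =>
    exact P.dual_integral_inf hq hA hB ha hb hrel (fun n => h₂.1 _ ⟨n, rfl⟩) h₀.2 h₁.2 h₂.2
  | b i c hc =>
    refine P.dual_integral_pt hq hA hB ha hb hrel (fun n => h₂.1 _ ⟨n, rfl⟩) ?_
    have h : qPoch P.q (1 / P.b i * Complex.exp c) = 0 := by
      rw [hc, one_div_mul_cancel (hb i), qPoch_one hq]
    fin_cases i <;> simp_all [dualCert]
  | Bx c hc =>
    obtain ⟨u, hu⟩ : ∃ u, u = c + (ξ - P.κ) := ⟨_, rfl⟩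
    have e1 : c + ξ = u + P.κ := by rw [hu]; ring
    have e2 : c + (ξ + P.κ) = u + P.κ + P.κ := by rw [hu]; ring
    have hexp : Complex.exp u = P.B * Complex.exp ξ / P.q := by
      rw [hu, Complex.exp_add, hc, exp_sub_kappa, mul_div_assoc]
    simp only [SigmaDefined, SigmaRegular, e1, e2, ← hu] at h₀ h₁ h₂ ⊢
    have z1 : P.dual ξ u = 0 := by
      have : P.q * Complex.exp u / (P.B * Complex.exp ξ) = 1 := by rw [hexp]; field_simp
      simp [dual, dualNum, this, qPoch_one hq]
    have z2 : ∀ v, v = u ∨ v = u + P.κ → P.dual (ξ + P.κ) v = 0 := by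
      intro v hv
      have : qPoch P.q (P.q * Complex.exp v / (P.B * Complex.exp (ξ + P.κ))) = 0 := by
        rcases hv with rfl | rfl
        · have : P.q * (P.q * Complex.exp v / (P.B * Complex.exp (ξ + P.κ))) = 1 := by
            rw [hexp, exp_add_kappa]; field_simp
          rw [qPoch_eq_mul hq, this, qPoch_one hq, mul_zero]
        · have : P.q * Complex.exp (u + P.κ) / (P.B * Complex.exp (ξ + P.κ)) = 1 := by
            rw [exp_add_kappa, hexp, exp_add_kappa]; field_simp
          rw [this, qPoch_one hq]
      simp [dual, dualNum, this]
    obtain ⟨c1, i1⟩ := Limit.integral_pt_add z1 h₁.2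
    obtain ⟨c2, i2⟩ := Limit.integral_pt_add (z2 _ (Or.inr rfl)) h₂.2
    obtain ⟨c2', i2'⟩ := Limit.integral_pt_add (z2 _ (Or.inl rfl)) c2
    rw [i1, i2, i2']
    refine P.dual_integral_pt hq hA hB ha hb hrel ?_ ?_
    · have hd := fun n : ℕ => h₀.1 (u + n * P.κ) ⟨n, rfl⟩
      have key := fun n hn => P.one_sub_div_mul_zpow_neg_ne_zero (hBA n hn)
      have hstep : ∀ v, P.dualDen (ξ - P.κ) v ≠ 0 →
          1 - Complex.exp v / (P.A * Complex.exp ξ) ≠ 0 →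
          1 - P.q * Complex.exp v / (P.A * Complex.exp ξ) ≠ 0 → P.dualDen (ξ + P.κ) v ≠ 0 := by
        intro v h h' h''
        rw [dualDen, mul_ne_zero_iff] at h ⊢
        refine ⟨?_, h.2⟩
        have q1 : P.q * Complex.exp v / (P.A * Complex.exp (ξ + P.κ)) =
            Complex.exp v / (P.A * Complex.exp ξ) := by rw [exp_add_kappa]; field_simp
        have q2 : P.q * (P.q * Complex.exp v / (P.A * Complex.exp ξ)) =
            P.q * Complex.exp v / (P.A * Complex.exp (ξ - P.κ)) := by
          rw [exp_sub_kappa]; field_simp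
        rw [q1, qPoch_eq_mul hq, mul_div_assoc', qPoch_eq_mul hq, q2]
        exact mul_ne_zero h' (mul_ne_zero h'' h.1)
      rintro (_ | _ | n)
      · refine hstep _ (hd 0) ?_ ?_
        · convert key 1 (by norm_num) using 2
          simp only [Nat.cast_zero, zero_mul, add_zero, hexp, zpow_neg, zpow_one]
          field_simp
        · convert key 0 (by norm_num) using 2
          simp only [Nat.cast_zero, zero_mul, add_zero, hexp, neg_zero, zpow_zero]
          field_simp
      · refine hstep _ (hd 1) ?_ ?_
        · convert key 0 (by norm_num) using 2
          simp only [zero_add, Nat.cast_one, one_mul, exp_add_kappa, hexp, neg_zero, zpow_zero]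
          field_simp
        · convert key (-1) (by norm_num) using 2
          simp only [zero_add, Nat.cast_one, one_mul, exp_add_kappa, hexp, neg_neg, zpow_one]
          field_simp
      · convert h₂.1 _ ⟨n, rfl⟩ using 2
        push_cast
        ring
    · have : P.q / (P.B * Complex.exp ξ) * Complex.exp u = 1 := by rw [hexp]; field_simp
      simp [dualCert, this, qPoch_one hq]

end Params

end QHyp

end

theorem mainTheorem3 (P : QHyp.Params) (hq : ‖P.q‖ < 1)
    (hA : P.A ≠ 0) (hB : P.B ≠ 0) (ha : ∀ i, P.a i ≠ 0) (hb : ∀ i, P.b i ≠ 0)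
    (hrel : P.A * P.a 0 * P.a 1 = P.qPow (P.α + 1) * P.B * P.b 0 * P.b 1)
    (hlam : P.qPow P.lam = P.B / P.A)
    (hBA : ∀ n : ℤ, -1 ≤ n → P.B / P.A ≠ P.q ^ n)
    (hαBA : ∀ n : ℤ, n ≤ 0 → P.qPow (P.α + 1) * P.B / P.A ≠ P.q ^ n) :
    -- the first integral solves the equation wherever it is defined
    (∀ τ₁ τ₂ : ℂ → QHyp.Limit, P.IsTau τ₁ → P.IsTau τ₂ → ∀ ξ : ℂ,
      (∀ η ∈ ({ξ - P.κ, ξ, ξ + P.κ} : Set ℂ), P.TauDefined τ₁ η ∧ P.TauDefined τ₂ η) →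
      P.E₂ (P.phi τ₁ τ₂) ξ = 0) ∧
    -- the dual integral solves the equation wherever it is defined
    (∀ σ₁ σ₂ : ℂ → QHyp.Limit, P.IsSigma σ₁ → P.IsSigma σ₂ → ∀ ξ : ℂ,
      (∀ η ∈ ({ξ - P.κ, ξ, ξ + P.κ} : Set ℂ), P.SigmaDefined σ₁ η ∧ P.SigmaDefined σ₂ η) →
      P.E₂ (P.phiDual σ₁ σ₂) ξ = 0) ∧
    -- convergence, away from zeros of the denominators
    (∀ τ : ℂ → QHyp.Limit, P.IsTau τ → ‖P.qPow P.α‖ < 1 → ∀ ξ : ℂ,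
      P.TauRegular τ ξ → P.TauDefined τ ξ) ∧
    (∀ σ : ℂ → QHyp.Limit, P.IsSigma σ → ∀ ξ : ℂ,
      ((∃ c, σ ξ = QHyp.Limit.inf c) → ‖P.qPow P.α‖ < 1) →
      P.SigmaRegular σ ξ → P.SigmaDefined σ ξ) := by
  refine ⟨fun τ₁ τ₂ hτ₁ hτ₂ ξ h => ?_, fun σ₁ σ₂ hσ₁ hσ₂ ξ h => ?_, fun τ hτ hα ξ h => ⟨h, ?_⟩,
    fun σ hσ ξ hα h => ⟨h, ?_⟩⟩
  · have h₀ := h (ξ - P.κ) (by simp)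
    have h₁ := h ξ (by simp)
    have h₂ := h (ξ + P.κ) (by simp)
    rw [P.E₂_apply]
    simp only [QHyp.Params.phi, QHyp.jackson]
    linear_combination P.psi_integral hq hA hB ha hrel hBA hτ₂ h₀.2 h₁.2 h₂.2 -
      P.psi_integral hq hA hB ha hrel hBA hτ₁ h₀.1 h₁.1 h₂.1
  · have h₀ := h (ξ - P.κ) (by simp)
    have h₁ := h ξ (by simp)
    have h₂ := h (ξ + P.κ) (by simp)
    have e2 : Complex.exp (P.lam * (ξ + P.κ)) = Complex.exp (P.lam * ξ) * (P.B / P.A) := by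
      rw [← hlam, QHyp.Params.qPow, ← Complex.exp_add, mul_add]
    have e0 : Complex.exp (P.lam * (ξ - P.κ)) = Complex.exp (P.lam * ξ) * (P.A / P.B) := by
      rw [← inv_div P.B P.A, ← hlam, QHyp.Params.qPow, ← Complex.exp_neg, ← Complex.exp_add]
      ring_nf
    rw [P.E₂_apply]
    simp only [QHyp.Params.phiDual, QHyp.jackson, e0, e2]
    linear_combination Complex.exp (P.lam * ξ) *
      (P.dual_integral hq hA hB ha hb hrel hBA hσ₂ h₀.2 h₁.2 h₂.2 -
        P.dual_integral hq hA hB ha hb hrel hBA hσ₁ h₀.1 h₁.1 h₂.1)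
  · cases hτ with
    | zero => trivial
    | overA i c hc => exact P.summable_psi hq hα ξ c
    | overAx c hc => exact P.summable_psi hq hα ξ (c - ξ)
  · cases hσ with
    | b i c hc => exact P.summable_dual hq ξ c
    | Bx c hc => exact P.summable_dual hq ξ (c + ξ)
    | inf c =>
      refine Summable.of_nat_of_neg (by simpa using P.summable_dual hq ξ c) ?_
      exact P.summable_dual_neg hq hA hB ha hb hrel (hα ⟨c, rfl⟩) ξ c
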